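/- Let $(X,d)$ be a complete metric space, $I$ a finite set, and $(f_i)_{i\in I}$ a family of continuous maps $f_i:X\to X$. For $x\in X$ let the orbit $\mathcal O(x)$ be the set of all points $f_{i_1}\circ\cdots\circ f_{i_n}(x)$ with $n\ge 0$ and $i_1,\dots,i_n\in I$ (so $x\in\mathcal O(x)$). Assume that there is $C\in[0,1)$ such that $$d(f_i(y),f_i(z))\le C\,d(y,z)\qquad\text{for all } x\in X,\ i\in I,\ y,z\in\mathcal O(x).$$ Let $(\rho_i)_{i\in I}$ be an admissible system of grey level maps: each $\rho_i:[0,1]\to[0,1]$ is not identically zero, non-decreasing and right-continuous, $\rho_i(0)=0$ for all $i\in I$, and $\rho_i(1)=1$ for some $i\in I$. For a fuzzy set $u:X\to[0,1]$ put $[u]^\alpha=\{x: u(x)\ge\alpha\}$ for $\alpha\in(0,1]$ and $[u]^0=\operatorname{supp}u=\overline{\{x:u(x)>0\}}$. Let $\mathcal F_{\mathcal S}^*$ be the set of all upper semicontinuous $u:X\to[0,1]$ with compact support that take the value $1$ somewhere and such that for every $x\in X$ with $u(x)>0$ there are $w\in X$ and $y\in\overline{\mathcal O(w)}$ with $x\in\overline{\mathcal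 O(w)}$ and $u(y)=1$. Let $d_\infty(u,v)=\sup_{\alpha\in[0,1]}h([u]^\alpha,[v]^\alpha)$, where $h$ is the Hausdorff–Pompeiu distance. Define $$Z(u)(y)=\max_{i\in I}\rho_i\bigl(f_i(u)(y)\bigr),\qquad f_i(u)(y)=\sup\{u(x): f_i(x)=y\}\quad(\sup\emptyset=0),$$ and $F_{\mathcal S}(K)=\bigcup_{i\in I}f_i(K)$ for $K\subseteq X$. Then $Z$ is a weakly Picard operator on $(\mathcal F_{\mathcal S}^*,d_\infty)$: $Z$ maps $\mathcal F_{\mathcal S}^*$ into itself, and for every $u\in\mathcal F_{\mathcal S}^*$ the sequence $(Z^n(u))_{n}$ converges in $d_\infty$ to some $\mathbf u_u\in\mathcal F_{\mathcal S}^*$ with $Z(\mathbf u_u)=\mathbf u_u$. Moreover, for every $u\in\mathcal F_{\mathcal S}^*$ and every $m\ge 0$, the limit satisfies $$d_\infty\bigl(Z^m(u),\mathbf u_u\bigr)\le\frac{C^m}{1-C}\,\operatorname{diam}\bigl(F_{\mathcal S}(\operatorname{supp}u)\cup\operatorname{supp}u\bigr).$$ -/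

import Mathlib

open Set Filter Topology
open scoped ENNReal unitInterval

namespace OrbitalFuzzy

/-! ### Fuzzy sets

A fuzzy subset of `X` is a function `u : X → I`, where `I = [0,1]` is Mathlib's `unitInterval`. -/

section FuzzySets

variable {X : Type*} [MetricSpace X]

/-- The support of a fuzzy set: the closure of the set where it is positive. -/
def fuzzySupp (u : X → I) : Set X := closure {x | 0 < u x}

open Classical in
/-- The `α`-cut: `{x | α ≤ u x}` for `α ∈ (0,1]`, and the support for `α = 0`. -/
def cut (u : X → I) (α : I) : Set X :=
  if α = 0 then fuzzySupp u else {x | α ≤ u x}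

/-- `F_X^{**}`: the normal, compactly supported fuzzy sets. -/
def normalCompact (X : Type*) [MetricSpace X] : Set (X → I) :=
  {u | (∃ x, u x = 1) ∧ IsCompact (fuzzySupp u)}

/-- `F_X^*`: the normal, compactly supported, upper semicontinuous fuzzy sets. -/
def normalCompactUsc (X : Type*) [MetricSpace X] : Set (X → I) :=
  {u | u ∈ normalCompact X ∧ UpperSemicontinuous u}

/-- `d_∞(u,v) = sup_{α ∈ [0,1]} h([u]^α, [v]^α)`, with `h` the Hausdorff-Pompeiu distance.
It is written with values in `[0,∞]`, so that a bound by a real number includes finiteness. -/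
noncomputable def dInf (u v : X → I) : ℝ≥0∞ :=
  ⨆ α : I, Metric.hausdorffEDist (cut u α) (cut v α)

/-- Zadeh's extension principle: `f(u)(y) = sup {u x | f x = y}`, which is the bottom element `0`
of `[0,1]` when `y` is not in the range of `f`. -/
noncomputable def zadeh (f : X → X) (u : X → I) : X → I :=
  fun y => ⨆ (x : X) (_ : f x = y), u x

end FuzzySets

/-! ### Grey level maps -/

/-- A non-decreasing, right-continuous, nonzero map `[0,1] → [0,1]`. -/
structure IsNdrc (ρ : I → I) : Prop where
  nonzero : ∃ t, ρ t ≠ 0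
  monotone : Monotone ρ
  rightCont : ∀ t, ContinuousWithinAt ρ (Ici t) t

/-- An admissible system of grey level maps. -/
structure IsAdmissible {ι : Type*} (ρ : ι → I → I) : Prop where
  ndrc : ∀ i, IsNdrc (ρ i)
  map_zero : ∀ i, ρ i 0 = 0
  map_one : ∃ i, ρ i 1 = 1

/-! ### Orbital contractive iterated function systems -/

section IFS

variable {X ι : Type*}

/-- `f_ω = f_{ω₁} ∘ ⋯ ∘ f_{ωₙ}` for a finite word `ω`, the empty word giving the identity. -/
def wordMap (f : ι → X → X) (ω : List ι) (x : X) : X := ω.foldr f x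

/-- The orbit `O(x)`: the images of `x` under all `f_ω`, `ω` a finite word (so `x ∈ O(x)`). -/
def orbit (f : ι → X → X) (x : X) : Set X := {y | ∃ ω : List ι, wordMap f ω x = y}

/-- The fractal operator `F_S(K) = ⋃ i, f_i(K)`. -/
def fractalOperator (f : ι → X → X) (K : Set X) : Set X := ⋃ i, f i '' K

variable [MetricSpace X]

/-- The maps are continuous and contract with the constant `C ∈ [0,1)` on each orbit. -/
structure IsOrbitalContractive (f : ι → X → X) (C : ℝ) : Prop where
  continuous : ∀ i, Continuous (f i)
  nonneg : 0 ≤ C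
  lt_one : C < 1
  contract : ∀ x, ∀ i, ∀ y ∈ orbit f x, ∀ z ∈ orbit f x,
    dist (f i y) (f i z) ≤ C * dist y z

/-- The fuzzy Hutchinson-Barnsley operator `Z(u) = ⋁ i, ρ_i(f_i(u))`. -/
noncomputable def fuzzyOperator (f : ι → X → X) (ρ : ι → I → I) (u : X → I) : X → I :=
  fun y => ⨆ i, ρ i (zadeh (f i) u y)

/-- `F_S^{**}`: the fuzzy sets in `F_X^{**}` such that every point where `u` is positive lies in
the closure of an orbit that also contains, in its closure, a point where `u` is `1`. -/
def orbitalNormalCompact (f : ι → X → X) : Set (X → I) :=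
  {u | u ∈ normalCompact X ∧ ∀ x, 0 < u x →
    ∃ w, ∃ y ∈ closure (orbit f w), x ∈ closure (orbit f w) ∧ u y = 1}

/-- `F_S^*`: the upper semicontinuous elements of `F_S^{**}`. -/
def orbitalNormalCompactUsc (f : ι → X → X) : Set (X → I) :=
  {u | u ∈ orbitalNormalCompact f ∧ UpperSemicontinuous u}

end IFS

/-- `T` is a weakly Picard operator on `S` with respect to the distance `d`: it maps `S` to itself
and, for each starting point in `S`, the iterates converge to a fixed point of `T` in `S`. -/
def IsWeaklyPicardOn {Y : Type*} (d : Y → Y → ℝ≥0∞) (T : Y → Y) (S : Set Y) : Prop :=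
  MapsTo T S S ∧ ∀ u ∈ S, ∃ v ∈ S, T v = v ∧ Tendsto (fun n : ℕ => d (T^[n] u) v) atTop (𝓝 0)

end OrbitalFuzzy

/-!
Along the closure of an orbit every map is a `C`-contraction, and every point where a fuzzy set
`u` of the class is positive shares such a closure with a point where `u` is `1`. Hence each point
of the hypograph of `u` is matched, at horizontal distance at most
`D = diam (F_S(supp u) ∪ supp u)` and inside one orbit closure, by a point of the hypograph of
`Z u`, and conversely. Applying `Z` shrinks such matchings by the factor `C`, so the iterates are
Cauchy at rate `C ^ n * D`. They converge to the infimum of their horizontal dilations by the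
tails `C ^ n / (1 - C) * D`, which is a fixed point because `Z` is continuous. The limit stays in
the class because orbit closures depend upper semicontinuously on their base point: up to a
uniformly small error, an orbit is given by finitely many words.
-/

namespace OrbitalFuzzy

section Orbit

variable {X ι : Type*} {f : ι → X → X}

theorem self_mem_orbit (f : ι → X → X) (x : X) : x ∈ orbit f x := ⟨[], rfl⟩

theorem mapsTo_orbit (f : ι → X → X) (i : ι) (w : X) : MapsTo (f i) (orbit f w) (orbit f w) := by
  rintro _ ⟨ω, rfl⟩
  exact ⟨i :: ω, rfl⟩

theorem mapsTo_wordMap {S : Set X} (hS : ∀ i, MapsTo (f i) S S) (ω : List ι) :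
    MapsTo (wordMap f ω) S S := by
  induction ω with
  | nil => exact mapsTo_id S
  | cons i ω ih => exact (hS i).comp ih

theorem wordMap_take_drop (f : ι → X → X) (n : ℕ) (ω : List ι) (x : X) :
    wordMap f (ω.take n) (wordMap f (ω.drop n) x) = wordMap f ω x := by
  rw [wordMap, wordMap, ← List.foldr_append, List.take_append_drop, wordMap]

theorem continuous_wordMap [TopologicalSpace X] (hf : ∀ i, Continuous (f i)) (ω : List ι) :
    Continuous (wordMap f ω) := by
  induction ω with
  | nil => exact continuous_id
  | cons i ω ih => exact (hf i).comp ih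

theorem isCompact_fractalOperator [TopologicalSpace X] [Finite ι]
    (hf : ∀ i, Continuous (f i)) {K : Set X} (hK : IsCompact K) : IsCompact (fractalOperator f K) :=
  isCompact_iUnion fun i => hK.image (hf i)

end Orbit

namespace IsOrbitalContractive

variable {X ι : Type*} [MetricSpace X] {f : ι → X → X} {C : ℝ}

theorem mapsTo_closure_orbit (hf : IsOrbitalContractive f C) (i : ι) (w : X) :
    MapsTo (f i) (closure (orbit f w)) (closure (orbit f w)) :=
  (mapsTo_orbit f i w).closure (hf.continuous i)

theorem lipschitzOnWith_closure_orbit (hf : IsOrbitalContractive f C) (i : ι) (w : X) :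
    LipschitzOnWith ⟨C, hf.nonneg⟩ (f i) (closure (orbit f w)) :=
  .closure (hf.continuous i).continuousOn
    (.of_dist_le_mul fun y hy z hz => hf.contract w i y hy z hz)

theorem dist_wordMap_le (hf : IsOrbitalContractive f C) {w x y : X}
    (hx : x ∈ closure (orbit f w)) (hy : y ∈ closure (orbit f w)) (ω : List ι) :
    dist (wordMap f ω x) (wordMap f ω y) ≤ C ^ ω.length * dist x y := by
  have hmaps := mapsTo_wordMap (fun i => hf.mapsTo_closure_orbit i w)
  induction ω with
  | nil => simp [wordMap]
  | cons i ω ih =>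
    calc dist (f i (wordMap f ω x)) (f i (wordMap f ω y))
        ≤ C * dist (wordMap f ω x) (wordMap f ω y) :=
          (hf.lipschitzOnWith_closure_orbit i w).dist_le_mul _ (hmaps ω hx) _ (hmaps ω hy)
      _ ≤ C * (C ^ ω.length * dist x y) := mul_le_mul_of_nonneg_left ih hf.nonneg
      _ = C ^ (i :: ω).length * dist x y := by rw [List.length_cons]; ring

theorem dist_wordMap_self_le (hf : IsOrbitalContractive f C) {z : X} {D : ℝ} (hD : 0 ≤ D)
    (hz : ∀ i, dist (f i z) z ≤ D) (ω : List ι) : dist (wordMap f ω z) z ≤ D / (1 - C) := by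
  have hC : 0 < 1 - C := sub_pos.2 hf.lt_one
  induction ω with
  | nil => simpa [wordMap] using div_nonneg hD hC.le
  | cons i ω ih =>
    calc dist (f i (wordMap f ω z)) z
        ≤ dist (f i (wordMap f ω z)) (f i z) + dist (f i z) z := dist_triangle _ _ _
      _ ≤ C * dist (wordMap f ω z) z + D :=
          add_le_add (hf.contract z i _ ⟨ω, rfl⟩ z (self_mem_orbit f z)) (hz i)
      _ ≤ C * (D / (1 - C)) + D := by gcongr; exact hf.nonneg
      _ = D / (1 - C) := by field_simp; ring

theorem dist_wordMap_take_le (hf : IsOrbitalContractive f C) {z : X} {D : ℝ} (hD : 0 ≤ D)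
    (hz : ∀ i, dist (f i z) z ≤ D) (n : ℕ) (ω : List ι) :
    dist (wordMap f ω z) (wordMap f (ω.take n) z) ≤ C ^ n * (D / (1 - C)) := by
  have hCn : 0 ≤ C ^ n := pow_nonneg hf.nonneg n
  rcases le_total ω.length n with h | h
  · rw [List.take_of_length_le h, dist_self]
    exact mul_nonneg hCn (div_nonneg hD (sub_pos.2 hf.lt_one).le)
  · have hdist := hf.dist_wordMap_le (subset_closure ⟨ω.drop n, rfl⟩)
      (subset_closure (self_mem_orbit f z)) (ω.take n)
    rw [wordMap_take_drop, List.length_take_of_le h] at hdist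
    exact hdist.trans (mul_le_mul_of_nonneg_left (hf.dist_wordMap_self_le hD hz _) hCn)

theorem exists_tendsto_iterate_mem_closure_orbit [CompleteSpace X]
    (hf : IsOrbitalContractive f C) (i : ι) (z : X) :
    ∃ y ∈ closure (orbit f z), Tendsto (fun n => (f i)^[n] z) atTop (𝓝 y) := by
  have hcontr : ContractingWith ⟨C, hf.nonneg⟩ ((hf.mapsTo_closure_orbit i z).restrict (f i) _ _) :=
    ⟨hf.lt_one, (hf.lipschitzOnWith_closure_orbit i z).mapsToRestrict _⟩
  obtain ⟨y, hy, -, hlim, -⟩ := hcontr.exists_fixedPoint' isClosed_closure.isComplete _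
    (subset_closure (self_mem_orbit f z)) (edist_ne_top _ _)
  exact ⟨y, hy, hlim⟩

theorem exists_eventually_dist_map_self_le [Finite ι] (hf : IsOrbitalContractive f C) (a : X) :
    ∃ D, 0 ≤ D ∧ ∀ᶠ z in 𝓝 a, ∀ i, dist (f i z) z ≤ D := by
  obtain ⟨M, hM⟩ := Finite.exists_le fun i => dist (f i a) a
  refine ⟨max M 0 + 1, by positivity, eventually_all.2 fun i => ?_⟩
  have hcont : ContinuousAt (fun z => dist (f i z) z) a :=
    (hf.continuous i).continuousAt.dist continuousAt_id
  filter_upwards [hcont.eventually (gt_mem_nhds (lt_add_one _))] with z hz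
  linarith [hM i, le_max_left M 0]

theorem isClosed_setOf_mem_closure_orbit [Finite ι] (hf : IsOrbitalContractive f C) :
    IsClosed {p : X × X | p.2 ∈ closure (orbit f p.1)} := by
  refine isClosed_of_closure_subset fun ⟨a, x⟩ hax => Metric.mem_closure_iff.2 fun ε hε => ?_
  have hε4 : 0 < ε / 4 := by positivity
  obtain ⟨D, hD, hdisp⟩ := hf.exists_eventually_dist_map_self_le a
  obtain ⟨n, hn⟩ : ∃ n, C ^ n * (D / (1 - C)) < ε / 4 := by
    have hlim := (tendsto_pow_atTop_nhds_zero_of_lt_one hf.nonneg hf.lt_one).mul_const (D / (1 - C))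
    rw [zero_mul] at hlim
    exact (hlim.eventually (gt_mem_nhds hε4)).exists
  have hwords : ∀ᶠ z in 𝓝 a, ∀ η ∈ {η : List ι | η.length ≤ n},
      dist (wordMap f η z) (wordMap f η a) < ε / 4 :=
    (List.finite_length_le ι n).eventually_all.2 fun η _ =>
      (continuous_wordMap hf.continuous η).continuousAt.eventually (Metric.ball_mem_nhds _ hε4)
  have hnear := (hdisp.and hwords).prod_nhds (Metric.ball_mem_nhds x hε4)
  obtain ⟨⟨z, y⟩, hy, ⟨hz, hzη⟩, hyx⟩ :=
    ((mem_closure_iff_frequently.1 hax).and_eventually hnear).exists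
  obtain ⟨_, ⟨ω, rfl⟩, hω⟩ := Metric.mem_closure_iff.1 hy _ hε4
  refine ⟨wordMap f (ω.take n) a, ⟨ω.take n, rfl⟩, ?_⟩
  have htake := hf.dist_wordMap_take_le hD hz n ω
  have hmove := hzη (ω.take n) (List.length_take_le n ω)
  have hxy : dist x y < ε / 4 := by rw [dist_comm]; exact hyx
  calc dist x (wordMap f (ω.take n) a)
      ≤ dist x y + dist y (wordMap f ω z) + dist (wordMap f ω z) (wordMap f (ω.take n) z) +
          dist (wordMap f (ω.take n) z) (wordMap f (ω.take n) a) :=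
        (dist_triangle _ _ _).trans (add_le_add_left (dist_triangle4 _ _ _ _) _)
    _ < ε := by linarith

end IsOrbitalContractive

section Semicontinuity

theorem upperSemicontinuous_of_forall_pos_isClosed {X : Type*} [TopologicalSpace X] {u : X → I}
    (h : ∀ α : I, 0 < α → IsClosed {x | α ≤ u x}) : UpperSemicontinuous u := by
  refine upperSemicontinuous_iff_isClosed_preimage.2 fun α => ?_
  rcases eq_zero_or_pos α with rfl | hα
  · rw [eq_univ_of_forall fun x => mem_preimage.2 (mem_Ici.2 unitInterval.nonneg')]
    exact isClosed_univ
  · exact h α hα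

theorem upperSemicontinuous_comp_of_monotone {X L M : Type*} [TopologicalSpace X] [LinearOrder L]
    [TopologicalSpace L] [OrderTopology L] [LinearOrder M] [TopologicalSpace M]
    [OrderTopology M] {ρ : L → M} {u : X → L} (hρ : Monotone ρ)
    (hright : ∀ t, ContinuousWithinAt ρ (Ici t) t) (hu : UpperSemicontinuous u) :
    UpperSemicontinuous (ρ ∘ u) := by
  intro x b hb
  have hmax : Tendsto (fun z => max (u x) (u z)) (𝓝 x) (𝓝[≥] (u x)) := by
    refine tendsto_nhdsWithin_iff.2 ⟨tendsto_order.2 ⟨fun c hc => ?_, fun c hc => ?_⟩,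
      .of_forall fun z => le_max_left _ _⟩
    · exact .of_forall fun z => hc.trans_le (le_max_left _ _)
    · exact (hu x c hc).mono fun z hz => max_lt hc hz
  exact (hmax.eventually ((hright (u x)).eventually (gt_mem_nhds hb))).mono fun z hz =>
    (hρ (le_max_right _ _)).trans_lt hz

end Semicontinuity

section FuzzySets

variable {X : Type*} [MetricSpace X]

theorem mem_fuzzySupp {u : X → I} {x : X} (h : 0 < u x) : x ∈ fuzzySupp u :=
  subset_closure h

theorem cut_zero (u : X → I) : cut u 0 = closure {x | 0 < u x} := if_pos rfl

theorem cut_of_pos (u : X → I) {α : I} (hα : 0 < α) : cut u α = {x | α ≤ u x} := if_neg hα.ne'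

/-- The upper semicontinuous fuzzy sets with compact support: `normalCompactUsc` without
normality. -/
def compactUsc (X : Type*) [MetricSpace X] : Set (X → I) :=
  {u | UpperSemicontinuous u ∧ IsCompact (fuzzySupp u)}

theorem orbitalNormalCompactUsc_subset_compactUsc {ι : Type*} (f : ι → X → X) :
    orbitalNormalCompactUsc f ⊆ compactUsc X :=
  fun _ hu => ⟨hu.2, hu.1.1.2⟩

theorem isCompact_setOf_le {u : X → I} (hu : u ∈ compactUsc X) {α : I} (hα : 0 < α) :
    IsCompact {x | α ≤ u x} :=
  hu.2.of_isClosed_subset (hu.1.isClosed_preimage α) fun _ hx => mem_fuzzySupp (hα.trans_le hx)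

theorem exists_mem_eq_biSup {u : X → I} (hu : u ∈ compactUsc X) {S : Set X} (hS : IsClosed S)
    (hpos : 0 < ⨆ x ∈ S, u x) : ∃ x ∈ S, u x = ⨆ x ∈ S, u x := by
  obtain ⟨x₀, hx₀S, hx₀⟩ : ∃ x ∈ S, 0 < u x := by simpa only [lt_iSup_iff, exists_prop] using hpos
  obtain ⟨x, hx, hmax⟩ := UpperSemicontinuousOn.exists_isMaxOn (f := u) (s := S ∩ fuzzySupp u)
    ⟨x₀, hx₀S, mem_fuzzySupp hx₀⟩ (hu.2.inter_left hS) (hu.1.upperSemicontinuousOn _)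
  refine ⟨x, hx.1, le_antisymm (le_iSup₂ (f := fun x _ => u x) x hx.1) (iSup₂_le fun y hy => ?_)⟩
  rcases eq_zero_or_pos (u y) with h0 | hy0
  · exact h0.trans_le unitInterval.nonneg'
  · exact hmax ⟨hy, mem_fuzzySupp hy0⟩

theorem dInf_comm (u v : X → I) : dInf u v = dInf v u :=
  iSup_congr fun _ => Metric.hausdorffEDist_comm

theorem dInf_triangle (u v w : X → I) : dInf u w ≤ dInf u v + dInf v w :=
  iSup_le fun α => Metric.hausdorffEDist_triangle.trans
    (add_le_add (le_iSup (fun α => Metric.hausdorffEDist (cut u α) (cut v α)) α)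
      (le_iSup (fun α => Metric.hausdorffEDist (cut v α) (cut w α)) α))

theorem dInf_le_of_tendsto {u : ℕ → X → I} {v v' : X → I} {e : ℕ → ℝ≥0∞}
    (he : Tendsto e atTop (𝓝 0)) (hle : ∀ n, dInf (u n) v ≤ e n)
    (hv' : Tendsto (fun n => dInf (u n) v') atTop (𝓝 0)) (n : ℕ) : dInf (u n) v' ≤ e n := by
  have hlim : Tendsto (fun k => e n + (e k + dInf (u k) v')) atTop (𝓝 (e n)) := by
    simpa only [add_zero] using tendsto_const_nhds.add (he.add hv')
  refine ge_of_tendsto' hlim fun k => ?_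
  calc dInf (u n) v' ≤ dInf (u n) v + dInf v v' := dInf_triangle _ _ _
    _ ≤ dInf (u n) v + (dInf v (u k) + dInf (u k) v') := by gcongr; exact dInf_triangle _ _ _
    _ ≤ e n + (e k + dInf (u k) v') := by
        rw [dInf_comm v]
        gcongr
        exacts [hle n, hle k]

end FuzzySets

section Domination

/-- Every point of the hypograph of `u` of positive height can be moved horizontally along the
relation `R` into the hypograph of `v`. -/
def DominatedAlong {X : Type*} (R : X → X → Prop) (u v : X → I) : Prop :=
  ∀ x, 0 < u x → ∃ y, R x y ∧ u x ≤ v y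

theorem DominatedAlong.mono {X : Type*} {R S : X → X → Prop} {u v : X → I}
    (h : DominatedAlong R u v) (hRS : ∀ x y, R x y → S x y) :
    DominatedAlong S u v :=
  fun x hx => (h x hx).imp fun y hy => ⟨hRS x y hy.1, hy.2⟩

variable {X : Type*} [MetricSpace X] {u v w : X → I}

/-- `DominatedAlong` for displacements of length at most `r`: together with the same property of
`v` and `u` it gives `dInf u v ≤ r`. -/
def DominatedWithin (r : ℝ) (u v : X → I) : Prop :=
  DominatedAlong (fun x y => dist x y ≤ r) u v

theorem DominatedWithin.mono {r s : ℝ} (h : DominatedWithin r u v) (hrs : r ≤ s) :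
    DominatedWithin s u v :=
  DominatedAlong.mono h fun _ _ hxy => hxy.trans hrs

theorem DominatedWithin.trans {r s : ℝ} (huv : DominatedWithin r u v)
    (hvw : DominatedWithin s v w) : DominatedWithin (r + s) u w := by
  intro x hx
  obtain ⟨y, hxy, huy⟩ := huv x hx
  obtain ⟨z, hyz, hvz⟩ := hvw y (hx.trans_le huy)
  exact ⟨z, (dist_triangle x y z).trans (add_le_add hxy hyz), huy.trans hvz⟩

theorem dInf_le_of_dominatedWithin {r : ℝ} (huv : DominatedWithin r u v)
    (hvu : DominatedWithin r v u) : dInf u v ≤ ENNReal.ofReal r := by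
  have hedist {u v : X → I} (h : DominatedWithin r u v) (x : X) (hx : 0 < u x) :
      ∃ y, u x ≤ v y ∧ edist x y ≤ ENNReal.ofReal r :=
    (h x hx).imp fun y hy => ⟨hy.2, (edist_dist x y).trans_le (ENNReal.ofReal_le_ofReal hy.1)⟩
  refine iSup_le fun α => ?_
  rcases eq_zero_or_pos α with rfl | hα
  · rw [cut_zero, cut_zero, Metric.hausdorffEDist_closure]
    exact Metric.hausdorffEDist_le_of_mem_edist
      (fun x hx => (hedist huv x hx).imp fun y hy => ⟨hx.trans_le hy.1, hy.2⟩)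
      (fun x hx => (hedist hvu x hx).imp fun y hy => ⟨hx.trans_le hy.1, hy.2⟩)
  · rw [cut_of_pos u hα, cut_of_pos v hα]
    exact Metric.hausdorffEDist_le_of_mem_edist
      (fun x hx => (hedist huv x (hα.trans_le hx)).imp fun y hy => ⟨hx.trans hy.1, hy.2⟩)
      (fun x hx => (hedist hvu x (hα.trans_le hx)).imp fun y hy => ⟨hx.trans hy.1, hy.2⟩)

theorem le_of_forall_dominatedWithin (hv : UpperSemicontinuous v)
    (h : ∀ ε > 0, DominatedWithin ε u v) : u ≤ v := by
  intro x
  rcases eq_zero_or_pos (u x) with hx | hx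
  · exact hx.trans_le unitInterval.nonneg'
  · suffices hcl : x ∈ closure (v ⁻¹' Ici (u x)) from (hv.isClosed_preimage _).closure_subset hcl
    refine Metric.mem_closure_iff.2 fun ε hε => ?_
    obtain ⟨y, hxy, hy⟩ := h (ε / 2) (half_pos hε) x hx
    exact ⟨y, hy, hxy.trans_lt (half_lt_self hε)⟩

theorem le_apply_of_tendsto {u : ℕ → X → I} {r : ℕ → ℝ} (hr : Tendsto r atTop (𝓝 0))
    (hv : UpperSemicontinuous v) (huv : ∀ n, DominatedWithin (r n) (u n) v) {x : ℕ → X} {a : X}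
    (hx : Tendsto x atTop (𝓝 a)) {α : I} (hα : 0 < α) (hαx : ∀ n, α ≤ u n (x n)) : α ≤ v a := by
  choose y hxy hy using fun n => huv n (x n) (hα.trans_le (hαx n))
  have hya : Tendsto y atTop (𝓝 a) :=
    (tendsto_iff_of_dist (squeeze_zero (fun _ => dist_nonneg) hxy hr)).1 hx
  exact (hv.isClosed_preimage α).mem_of_tendsto hya (.of_forall fun n => (hαx n).trans (hy n))

theorem isCompact_fuzzySupp_of_forall_dominatedWithin [CompleteSpace X]
    (h : ∀ ε > 0, ∃ u, IsCompact (fuzzySupp u) ∧ DominatedWithin ε v u) :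
    IsCompact (fuzzySupp v) := by
  refine (TotallyBounded.closure (Metric.totallyBounded_iff.2 fun ε hε => ?_)).isCompact_of_isClosed
    isClosed_closure
  obtain ⟨u, hu, hvu⟩ := h (ε / 2) (half_pos hε)
  obtain ⟨t, ht, hcover⟩ := Metric.totallyBounded_iff.1 hu.totallyBounded (ε / 2) (half_pos hε)
  refine ⟨t, ht, fun x hx => ?_⟩
  obtain ⟨y, hxy, hy⟩ := hvu x hx
  obtain ⟨z, hz, hyz⟩ := mem_iUnion₂.1 (hcover (mem_fuzzySupp (lt_of_lt_of_le hx hy)))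
  refine mem_iUnion₂.2 ⟨z, hz, ?_⟩
  rw [Metric.mem_ball] at hyz ⊢
  linarith [dist_triangle x y z]

end Domination

section Completeness

variable {X : Type*} [MetricSpace X] {u v : X → I} {r s : ℝ}

/-- The dilation of a fuzzy set by closed balls of radius `r`: its hypograph consists of the points
at horizontal distance at most `r` from the hypograph of `u`, when the suprema are attained. -/
noncomputable def dilate (r : ℝ) (u : X → I) (x : X) : I := ⨆ y ∈ Metric.closedBall x r, u y

theorem le_dilate {x y : X} (h : dist x y ≤ r) : u y ≤ dilate r u x :=
  le_iSup₂ (f := fun y _ => u y) y (Metric.mem_closedBall'.2 h)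

theorem dominatedWithin_dilate (hu : u ∈ compactUsc X) : DominatedWithin r (dilate r u) u := by
  intro x hx
  obtain ⟨y, hy, hyu⟩ := exists_mem_eq_biSup hu Metric.isClosed_closedBall hx
  exact ⟨y, Metric.mem_closedBall'.1 hy, hyu.ge⟩

theorem upperSemicontinuous_dilate (hu : u ∈ compactUsc X) (hr : 0 ≤ r) :
    UpperSemicontinuous (dilate r u) := by
  refine upperSemicontinuous_of_forall_pos_isClosed fun α hα => ?_
  suffices heq : {x | α ≤ dilate r u x} = Metric.cthickening r {x | α ≤ u x} from
    heq ▸ Metric.isClosed_cthickening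
  rw [(isCompact_setOf_le hu hα).cthickening_eq_biUnion_closedBall hr]
  ext x
  simp only [mem_ofPred_eq, mem_iUnion, Metric.mem_closedBall, exists_prop]
  constructor
  · intro hx
    obtain ⟨y, hxy, hy⟩ := dominatedWithin_dilate hu x (hα.trans_le hx)
    exact ⟨y, hx.trans hy, hxy⟩
  · rintro ⟨y, hy, hxy⟩
    exact hy.trans (le_dilate hxy)

theorem dilate_le_dilate (h : DominatedWithin s v u) : dilate r v ≤ dilate (s + r) u := by
  refine fun x => iSup₂_le fun y hy => ?_
  rcases eq_zero_or_pos (v y) with hy0 | hy0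
  · exact hy0.trans_le unitInterval.nonneg'
  · obtain ⟨z, hyz, hz⟩ := h y hy0
    refine hz.trans (le_dilate ?_)
    linarith [dist_triangle x y z, Metric.mem_closedBall'.1 hy]

theorem exists_seq_of_dominatedWithin {u : ℕ → X → I} {d : ℕ → ℝ}
    (h : ∀ n, DominatedWithin (d n) (u n) (u (n + 1))) {x : X} (hx : 0 < u 0 x) :
    ∃ s : ℕ → X, s 0 = x ∧ ∀ n, dist (s n) (s (n + 1)) ≤ d n ∧ u 0 x ≤ u n (s n) := by
  have : Nonempty X := ⟨x⟩
  choose! g hdist hle using h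
  let s : ℕ → X := Nat.rec x g
  have hs (n : ℕ) : u 0 x ≤ u n (s n) := by
    induction n with
    | zero => exact le_rfl
    | succ n ih => exact ih.trans (hle n (s n) (hx.trans_le ih))
  exact ⟨s, rfl, fun n => ⟨hdist n (s n) (hx.trans_le (hs n)), hs n⟩⟩

theorem exists_tendsto_of_dominatedWithin [CompleteSpace X] {u : ℕ → X → I} {d : ℕ → ℝ}
    (hd : Summable d) (h : ∀ n, DominatedWithin (d n) (u n) (u (n + 1))) {x : X} (hx : 0 < u 0 x) :
    ∃ (s : ℕ → X) (a : X), dist x a ≤ ∑' k, d k ∧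
      ∀ n, dist (s n) a ≤ ∑' k, d (n + k) ∧ u 0 x ≤ u n (s n) := by
  obtain ⟨s, rfl, hs⟩ := exists_seq_of_dominatedWithin h hx
  obtain ⟨a, ha⟩ := cauchySeq_tendsto_of_complete
    (cauchySeq_of_dist_le_of_summable d (fun n => (hs n).1) hd)
  have hdist := dist_le_tsum_of_dist_le_of_tendsto d (fun n => (hs n).1) hd ha
  exact ⟨s, a, by simpa only [zero_add] using hdist 0, fun n => ⟨hdist n, (hs n).2⟩⟩

theorem exists_limit_of_summable [CompleteSpace X] {u : ℕ → X → I} {d : ℕ → ℝ}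
    (hu : ∀ n, u n ∈ compactUsc X) (hd₀ : ∀ n, 0 ≤ d n) (hd : Summable d)
    (hsucc : ∀ n, DominatedWithin (d n) (u n) (u (n + 1)))
    (hpred : ∀ n, DominatedWithin (d n) (u (n + 1)) (u n)) :
    ∃ v ∈ compactUsc X, (∀ n, DominatedWithin (∑' k, d (n + k)) (u n) v) ∧
      ∀ n, DominatedWithin (∑' k, d (n + k)) v (u n) := by
  let r (n : ℕ) : ℝ := ∑' k, d (n + k)
  let v (x : X) : I := ⨅ n, dilate (r n) (u n) x
  have hsum (n : ℕ) : Summable fun k => d (n + k) := hd.comp_injective (add_right_injective n)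
  have hr_lim : Tendsto r atTop (𝓝 0) := by
    simpa only [r, add_comm] using tendsto_sum_nat_add d
  have hr_succ (n : ℕ) : r n = d n + r (n + 1) := by
    simpa only [r, add_zero, add_assoc, add_comm 1] using (hsum n).tsum_eq_zero_add
  have hanti : Antitone fun n => dilate (r n) (u n) := antitone_nat_of_succ_le fun n => by
    rw [hr_succ n]
    exact dilate_le_dilate (hpred n)
  have hvu (n : ℕ) : DominatedWithin (r n) v (u n) := fun x hx => by
    have hle : v x ≤ dilate (r n) (u n) x := iInf_le _ n
    obtain ⟨y, hxy, hy⟩ := dominatedWithin_dilate (hu n) x (hx.trans_le hle)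
    exact ⟨y, hxy, hle.trans hy⟩
  have huv (n : ℕ) : DominatedWithin (r n) (u n) v := fun x hx => by
    obtain ⟨s, a, hxa, hs⟩ := exists_tendsto_of_dominatedWithin (u := fun k => u (n + k))
      (hsum n) (fun k => hsucc (n + k)) hx
    refine ⟨a, hxa, le_iInf fun m => ?_⟩
    calc u n x ≤ u (n + m) (s m) := (hs m).2
      _ ≤ dilate (r (n + m)) (u (n + m)) a := le_dilate (by
          simpa only [r, add_assoc, dist_comm a] using (hs m).1)
      _ ≤ dilate (r m) (u m) a := hanti (Nat.le_add_left m n) a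
  refine ⟨v, ⟨?_, ?_⟩, huv, hvu⟩
  · exact upperSemicontinuous_iInf fun n =>
      upperSemicontinuous_dilate (hu n) (tsum_nonneg fun k => hd₀ (n + k))
  · refine isCompact_fuzzySupp_of_forall_dominatedWithin fun ε hε => ?_
    obtain ⟨n, hn⟩ := (hr_lim.eventually (ge_mem_nhds hε)).exists
    exact ⟨u n, (hu n).2, (hvu n).mono hn⟩

end Completeness

section Operator

variable {X ι : Type*} {f : ι → X → X} {ρ : ι → I → I}

theorem pos_of_map_pos {ρ : I → I} (h0 : ρ 0 = 0) {t : I} (h : 0 < ρ t) : 0 < t := by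
  rw [unitInterval.pos_iff_ne_zero] at h ⊢
  rintro rfl
  exact h h0

theorem le_fuzzyOperator (f : ι → X → X) {i : ι} (hρ : Monotone (ρ i)) (u : X → I) (x : X) :
    ρ i (u x) ≤ fuzzyOperator f ρ u (f i x) :=
  (hρ (le_iSup₂ (f := fun z (_ : f i z = f i x) => u z) x rfl)).trans
    (le_iSup (fun j => ρ j (zadeh (f j) u (f i x))) i)

theorem fuzzyOperator_map_eq_one {i : ι} (hρ : Monotone (ρ i)) (hi : ρ i 1 = 1) {u : X → I}
    {x : X} (hx : u x = 1) : fuzzyOperator f ρ u (f i x) = 1 :=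
  le_antisymm unitInterval.le_one' (by simpa only [hx, hi] using le_fuzzyOperator f hρ u x)

theorem iterate_fuzzyOperator_iterate_eq_one {i : ι} (hρ : Monotone (ρ i)) (hi : ρ i 1 = 1)
    {u : X → I} {x : X} (hx : u x = 1) (n : ℕ) :
    (fuzzyOperator f ρ)^[n] u ((f i)^[n] x) = 1 := by
  induction n with
  | zero => exact hx
  | succ n ih =>
    rw [Function.iterate_succ_apply', Function.iterate_succ_apply']
    exact fuzzyOperator_map_eq_one hρ hi ih

variable [MetricSpace X] [Finite ι] {u v : X → I}

theorem exists_fuzzyOperator_eq (hf : ∀ i, Continuous (f i)) (h0 : ∀ i, ρ i 0 = 0)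
    (hu : u ∈ compactUsc X) {y : X} (hy : 0 < fuzzyOperator f ρ u y) :
    ∃ i x, f i x = y ∧ 0 < u x ∧ fuzzyOperator f ρ u y = ρ i (u x) := by
  have : Nonempty ι := (lt_iSup_iff.1 hy).nonempty
  obtain ⟨i, hi⟩ : ∃ i, ρ i (zadeh (f i) u y) = fuzzyOperator f ρ u y := exists_eq_ciSup_of_finite
  have hpos : 0 < zadeh (f i) u y := pos_of_map_pos (h0 i) (hi ▸ hy)
  obtain ⟨x, hx, hux⟩ : ∃ x, f i x = y ∧ u x = zadeh (f i) u y :=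
    exists_mem_eq_biSup hu (isClosed_singleton.preimage (hf i)) hpos
  exact ⟨i, x, hx, hux ▸ hpos, by rw [hux, hi]⟩

theorem setOf_le_fuzzyOperator (hf : ∀ i, Continuous (f i)) (hρ : IsAdmissible ρ)
    (hu : u ∈ compactUsc X) {α : I} (hα : 0 < α) :
    {y | α ≤ fuzzyOperator f ρ u y} = ⋃ i, f i '' {x | α ≤ ρ i (u x)} := by
  ext y
  simp only [mem_ofPred_eq, mem_iUnion, mem_image]
  constructor
  · intro hy
    obtain ⟨i, x, hx, -, hyx⟩ := exists_fuzzyOperator_eq hf hρ.map_zero hu (hα.trans_le hy)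
    exact ⟨i, x, hyx ▸ hy, hx⟩
  · rintro ⟨i, x, hx, rfl⟩
    exact hx.trans (le_fuzzyOperator f (hρ.ndrc i).monotone u x)

theorem upperSemicontinuous_fuzzyOperator (hf : ∀ i, Continuous (f i)) (hρ : IsAdmissible ρ)
    (hu : u ∈ compactUsc X) : UpperSemicontinuous (fuzzyOperator f ρ u) := by
  refine upperSemicontinuous_of_forall_pos_isClosed fun α hα => ?_
  rw [setOf_le_fuzzyOperator hf hρ hu hα]
  refine (isCompact_iUnion fun i => IsCompact.image ?_ (hf i)).isClosed
  have husc := upperSemicontinuous_comp_of_monotone (hρ.ndrc i).monotone (hρ.ndrc i).rightCont hu.1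
  exact hu.2.of_isClosed_subset (husc.isClosed_preimage α) fun x hx =>
    mem_fuzzySupp (pos_of_map_pos (hρ.map_zero i) (lt_of_lt_of_le hα hx))

theorem fuzzyOperator_mem_compactUsc (hf : ∀ i, Continuous (f i)) (hρ : IsAdmissible ρ)
    (hu : u ∈ compactUsc X) : fuzzyOperator f ρ u ∈ compactUsc X := by
  refine ⟨upperSemicontinuous_fuzzyOperator hf hρ hu, ?_⟩
  have hK := isCompact_fractalOperator hf hu.2
  refine hK.of_isClosed_subset isClosed_closure (closure_minimal (fun y hy => ?_) hK.isClosed)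
  obtain ⟨i, x, rfl, hx, -⟩ := exists_fuzzyOperator_eq hf hρ.map_zero hu hy
  exact mem_iUnion.2 ⟨i, mem_image_of_mem _ (mem_fuzzySupp hx)⟩

theorem iterate_fuzzyOperator_mem_compactUsc (hf : ∀ i, Continuous (f i)) (hρ : IsAdmissible ρ)
    (hu : u ∈ compactUsc X) (n : ℕ) : (fuzzyOperator f ρ)^[n] u ∈ compactUsc X :=
  MapsTo.iterate (fun _ => fuzzyOperator_mem_compactUsc hf hρ) n hu

theorem DominatedAlong.map_fuzzyOperator {R S : X → X → Prop} (h : DominatedAlong R u v)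
    (hf : ∀ i, Continuous (f i)) (hρ : IsAdmissible ρ) (hu : u ∈ compactUsc X)
    (hRS : ∀ i x y, 0 < u x → 0 < v y → R x y → S (f i x) (f i y)) :
    DominatedAlong S (fuzzyOperator f ρ u) (fuzzyOperator f ρ v) := by
  intro y hy
  obtain ⟨i, x, rfl, hx, hyx⟩ := exists_fuzzyOperator_eq hf hρ.map_zero hu hy
  obtain ⟨z, hxz, hz⟩ := h x hx
  refine ⟨f i z, hRS i x z hx (hx.trans_le hz) hxz, ?_⟩
  rw [hyx]
  exact ((hρ.ndrc i).monotone hz).trans (le_fuzzyOperator f (hρ.ndrc i).monotone v z)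

theorem exists_pos_forall_dist_map_le (hf : ∀ i, Continuous (f i)) {K : Set X} (hK : IsCompact K)
    {ε : ℝ} (hε : 0 < ε) :
    ∃ δ > 0, ∀ i, ∀ x ∈ K, ∀ y, dist x y ≤ δ → dist (f i x) (f i y) ≤ ε := by
  have hunif : ∀ᶠ p in uniformity X, ∀ i, p.1 ∈ K → dist (f i p.1) (f i p.2) < ε :=
    eventually_all.2 fun i => hK.uniformContinuousAt_of_continuousAt (f i)
      (fun _ _ => (hf i).continuousAt) (Metric.dist_mem_uniformity hε)
  obtain ⟨δ, hδ, h⟩ := Metric.mem_uniformity_dist.1 hunif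
  exact ⟨δ / 2, half_pos hδ, fun i x hx y hxy =>
    (h (hxy.trans_lt (half_lt_self hδ)) i hx).le⟩

theorem exists_pos_dominatedWithin_fuzzyOperator (hf : ∀ i, Continuous (f i))
    (hρ : IsAdmissible ρ) (hv : v ∈ compactUsc X) {ε : ℝ} (hε : 0 < ε) :
    ∃ δ > 0, ∀ u ∈ compactUsc X,
      (DominatedWithin δ u v → DominatedWithin ε (fuzzyOperator f ρ u) (fuzzyOperator f ρ v)) ∧
      (DominatedWithin δ v u → DominatedWithin ε (fuzzyOperator f ρ v) (fuzzyOperator f ρ u)) := by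
  obtain ⟨δ, hδ, hmod⟩ := exists_pos_forall_dist_map_le hf hv.2 hε
  refine ⟨δ, hδ, fun u hu => ⟨fun huv => ?_, fun hvu => ?_⟩⟩
  · refine DominatedAlong.map_fuzzyOperator huv hf hρ hu fun i x y _ hy hxy => ?_
    rw [dist_comm] at hxy ⊢
    exact hmod i y (mem_fuzzySupp hy) x hxy
  · exact DominatedAlong.map_fuzzyOperator hvu hf hρ hv fun i x y hx _ =>
      hmod i x (mem_fuzzySupp hx) y

theorem fuzzyOperator_eq_self_of_dominatedWithin (hf : ∀ i, Continuous (f i))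
    (hρ : IsAdmissible ρ) (hu : u ∈ compactUsc X) (hv : v ∈ compactUsc X) {r : ℕ → ℝ}
    (hr : Tendsto r atTop (𝓝 0)) (huv : ∀ n, DominatedWithin (r n) ((fuzzyOperator f ρ)^[n] u) v)
    (hvu : ∀ n, DominatedWithin (r n) v ((fuzzyOperator f ρ)^[n] u)) :
    fuzzyOperator f ρ v = v := by
  have hboth (ε : ℝ) (hε : 0 < ε) :
      DominatedWithin ε (fuzzyOperator f ρ v) v ∧ DominatedWithin ε v (fuzzyOperator f ρ v) := by
    obtain ⟨δ, hδ, hcont⟩ := exists_pos_dominatedWithin_fuzzyOperator hf hρ hv (half_pos hε)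
    obtain ⟨n, hnδ, hnε⟩ := ((hr.eventually (ge_mem_nhds hδ)).and
      ((hr.comp (tendsto_add_atTop_nat 1)).eventually (ge_mem_nhds (half_pos hε)))).exists
    obtain ⟨hZuv, hZvu⟩ := hcont _ (iterate_fuzzyOperator_mem_compactUsc hf hρ hu n)
    rw [← Function.iterate_succ_apply' (fuzzyOperator f ρ)] at hZuv hZvu
    rw [← add_halves ε]
    exact ⟨(hZvu ((hvu n).mono hnδ)).trans ((huv (n + 1)).mono hnε),
      ((hvu (n + 1)).mono hnε).trans (hZuv ((huv n).mono hnδ))⟩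
  exact le_antisymm (le_of_forall_dominatedWithin hv.1 fun ε hε => (hboth ε hε).1)
    (le_of_forall_dominatedWithin (upperSemicontinuous_fuzzyOperator hf hρ hv)
      fun ε hε => (hboth ε hε).2)

theorem mapsTo_fuzzyOperator {C : ℝ} (hf : IsOrbitalContractive f C) (hρ : IsAdmissible ρ) :
    MapsTo (fuzzyOperator f ρ) (orbitalNormalCompactUsc f) (orbitalNormalCompactUsc f) := by
  intro u hu
  have hu' := orbitalNormalCompactUsc_subset_compactUsc f hu
  obtain ⟨⟨⟨⟨x₀, hx₀⟩, -⟩, horb⟩, -⟩ := hu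
  obtain ⟨j, hj⟩ := hρ.map_one
  have hone {x : X} (hx : u x = 1) : fuzzyOperator f ρ u (f j x) = 1 :=
    fuzzyOperator_map_eq_one (hρ.ndrc j).monotone hj hx
  have hZu := fuzzyOperator_mem_compactUsc hf.continuous hρ hu'
  refine ⟨⟨⟨⟨f j x₀, hone hx₀⟩, hZu.2⟩, fun y hy => ?_⟩, hZu.1⟩
  obtain ⟨i, x, rfl, hx, -⟩ := exists_fuzzyOperator_eq hf.continuous hρ.map_zero hu' hy
  obtain ⟨w, z, hzw, hxw, hz⟩ := horb x hx
  exact ⟨w, f j z, hf.mapsTo_closure_orbit j w hzw, hf.mapsTo_closure_orbit i w hxw, hone hz⟩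

end Operator

section Geometric

variable {C : ℝ}

theorem tsum_pow_add_mul (h₀ : 0 ≤ C) (h₁ : C < 1) (D : ℝ) (n : ℕ) :
    ∑' k, C ^ (n + k) * D = C ^ n / (1 - C) * D := by
  simp only [pow_add, tsum_mul_right, tsum_mul_left, tsum_geometric_of_lt_one h₀ h₁,
    div_eq_mul_inv]

theorem tendsto_pow_div_mul (h₀ : 0 ≤ C) (h₁ : C < 1) (D : ℝ) :
    Tendsto (fun n : ℕ => C ^ n / (1 - C) * D) atTop (𝓝 0) := by
  simpa only [zero_div, zero_mul] using
    ((tendsto_pow_atTop_nhds_zero_of_lt_one h₀ h₁).div_const (1 - C)).mul_const D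

end Geometric

section Iterates

variable {X ι : Type*} [MetricSpace X] {f : ι → X → X} {ρ : ι → I → I} {C : ℝ} {u v : X → I}

/-- Two points at distance at most `r` lying in the closure of a common orbit. -/
def OrbitClose (f : ι → X → X) (r : ℝ) (x y : X) : Prop :=
  dist x y ≤ r ∧ ∃ w, x ∈ closure (orbit f w) ∧ y ∈ closure (orbit f w)

theorem OrbitClose.map {r : ℝ} {x y : X} (h : OrbitClose f r x y)
    (hf : IsOrbitalContractive f C) (i : ι) : OrbitClose f (C * r) (f i x) (f i y) := by
  obtain ⟨hxy, w, hx, hy⟩ := h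
  exact ⟨((hf.lipschitzOnWith_closure_orbit i w).dist_le_mul x hx y hy).trans
    (mul_le_mul_of_nonneg_left hxy hf.nonneg),
    w, hf.mapsTo_closure_orbit i w hx, hf.mapsTo_closure_orbit i w hy⟩

/-- The diameter of `F_S(supp u) ∪ supp u`, which bounds the distance from `u` to `Z u`. -/
noncomputable def initialDiam (f : ι → X → X) (u : X → I) : ℝ :=
  Metric.diam (fractalOperator f (fuzzySupp u) ∪ fuzzySupp u)

theorem exists_mem_closure_orbit_eq_one [CompleteSpace X] (hf : IsOrbitalContractive f C)
    (hρ : IsAdmissible ρ) (hv : UpperSemicontinuous v) {r : ℕ → ℝ} (hr : Tendsto r atTop (𝓝 0))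
    (huv : ∀ n, DominatedWithin (r n) ((fuzzyOperator f ρ)^[n] u) v) {z : X} (hz : u z = 1) :
    ∃ y ∈ closure (orbit f z), v y = 1 := by
  obtain ⟨j, hj⟩ := hρ.map_one
  obtain ⟨y, hy, hlim⟩ := hf.exists_tendsto_iterate_mem_closure_orbit j z
  refine ⟨y, hy, le_antisymm unitInterval.le_one' ?_⟩
  exact le_apply_of_tendsto hr hv huv hlim one_pos fun n =>
    (iterate_fuzzyOperator_iterate_eq_one (hρ.ndrc j).monotone hj hz n).ge

variable [Finite ι]

theorem DominatedAlong.iterate_fuzzyOperator {r : ℝ} (h : DominatedAlong (OrbitClose f r) u v)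
    (hf : IsOrbitalContractive f C) (hρ : IsAdmissible ρ) (hu : u ∈ compactUsc X) (n : ℕ) :
    DominatedAlong (OrbitClose f (C ^ n * r)) ((fuzzyOperator f ρ)^[n] u)
      ((fuzzyOperator f ρ)^[n] v) := by
  induction n with
  | zero => rwa [pow_zero, one_mul]
  | succ n ih =>
    rw [Function.iterate_succ_apply', Function.iterate_succ_apply', pow_succ', mul_assoc]
    exact ih.map_fuzzyOperator hf.continuous hρ
      (iterate_fuzzyOperator_mem_compactUsc hf.continuous hρ hu n)
      fun i _ _ _ _ hxy => hxy.map hf i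

theorem dist_le_initialDiam (hf : ∀ i, Continuous (f i)) (hu : u ∈ compactUsc X) {x y : X}
    (hx : x ∈ fractalOperator f (fuzzySupp u) ∪ fuzzySupp u)
    (hy : y ∈ fractalOperator f (fuzzySupp u) ∪ fuzzySupp u) : dist x y ≤ initialDiam f u :=
  Metric.dist_le_diam_of_mem ((isCompact_fractalOperator hf hu.2).union hu.2).isBounded hx hy

theorem exists_eq_one_orbitClose (hf : IsOrbitalContractive f C)
    (hu : u ∈ orbitalNormalCompactUsc f) {x : X} (hx : 0 < u x) :
    ∃ z, u z = 1 ∧ OrbitClose f (initialDiam f u) x z ∧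
      ∀ i, OrbitClose f (initialDiam f u) (f i x) z ∧ OrbitClose f (initialDiam f u) x (f i z) := by
  have hu' := orbitalNormalCompactUsc_subset_compactUsc f hu
  obtain ⟨w, z, hzw, hxw, hz⟩ := hu.1.2 x hx
  have hxs : x ∈ fuzzySupp u := mem_fuzzySupp hx
  have hzs : z ∈ fuzzySupp u := mem_fuzzySupp (hz ▸ one_pos)
  have hmap {y : X} (hy : y ∈ fuzzySupp u) (i : ι) : f i y ∈ fractalOperator f (fuzzySupp u) :=
    mem_iUnion.2 ⟨i, mem_image_of_mem _ hy⟩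
  have hdist {x y : X} := dist_le_initialDiam (x := x) (y := y) hf.continuous hu'
  exact ⟨z, hz, ⟨hdist (.inr hxs) (.inr hzs), w, hxw, hzw⟩, fun i =>
    ⟨⟨hdist (.inl (hmap hxs i)) (.inr hzs), w, hf.mapsTo_closure_orbit i w hxw, hzw⟩,
      hdist (.inr hxs) (.inl (hmap hzs i)), w, hxw, hf.mapsTo_closure_orbit i w hzw⟩⟩

theorem dominatedAlong_fuzzyOperator (hf : IsOrbitalContractive f C) (hρ : IsAdmissible ρ)
    (hu : u ∈ orbitalNormalCompactUsc f) :
    DominatedAlong (OrbitClose f (initialDiam f u)) u (fuzzyOperator f ρ u) := by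
  intro x hx
  obtain ⟨j, hj⟩ := hρ.map_one
  obtain ⟨z, hz, -, hxz⟩ := exists_eq_one_orbitClose hf hu hx
  refine ⟨f j z, (hxz j).2, unitInterval.le_one'.trans_eq ?_⟩
  exact (fuzzyOperator_map_eq_one (hρ.ndrc j).monotone hj hz).symm

theorem fuzzyOperator_dominatedAlong (hf : IsOrbitalContractive f C) (hρ : IsAdmissible ρ)
    (hu : u ∈ orbitalNormalCompactUsc f) :
    DominatedAlong (OrbitClose f (initialDiam f u)) (fuzzyOperator f ρ u) u := by
  intro y hy
  obtain ⟨i, x, rfl, hx, -⟩ := exists_fuzzyOperator_eq hf.continuous hρ.map_zero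
    (orbitalNormalCompactUsc_subset_compactUsc f hu) hy
  obtain ⟨z, hz, -, hxz⟩ := exists_eq_one_orbitClose hf hu hx
  exact ⟨z, (hxz i).1, unitInterval.le_one'.trans_eq hz.symm⟩

theorem exists_limit_iterate_fuzzyOperator [CompleteSpace X] (hf : IsOrbitalContractive f C)
    (hρ : IsAdmissible ρ) (hu : u ∈ orbitalNormalCompactUsc f) :
    ∃ v ∈ compactUsc X,
      (∀ n, DominatedWithin (C ^ n / (1 - C) * initialDiam f u) ((fuzzyOperator f ρ)^[n] u) v) ∧
      ∀ n, DominatedWithin (C ^ n / (1 - C) * initialDiam f u) v ((fuzzyOperator f ρ)^[n] u) := by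
  have hu' := orbitalNormalCompactUsc_subset_compactUsc f hu
  have hZu := fuzzyOperator_mem_compactUsc hf.continuous hρ hu'
  simp only [← tsum_pow_add_mul hf.nonneg hf.lt_one]
  exact exists_limit_of_summable (iterate_fuzzyOperator_mem_compactUsc hf.continuous hρ hu')
    (fun n => mul_nonneg (pow_nonneg hf.nonneg n) Metric.diam_nonneg)
    ((summable_geometric_of_lt_one hf.nonneg hf.lt_one).mul_right _)
    (fun n => ((dominatedAlong_fuzzyOperator hf hρ hu).iterate_fuzzyOperator hf hρ hu' n).mono
      fun _ _ h => h.1)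
    (fun n => ((fuzzyOperator_dominatedAlong hf hρ hu).iterate_fuzzyOperator hf hρ hZu n).mono
      fun _ _ h => h.1)

theorem exists_mem_orbit_orbitClose (hf : IsOrbitalContractive f C) (hρ : IsAdmissible ρ)
    (hu : u ∈ orbitalNormalCompactUsc f) (n : ℕ) {y : X}
    (hy : 0 < (fuzzyOperator f ρ)^[n] u y) :
    ∃ z, u z = 1 ∧ ∃ q ∈ orbit f z, OrbitClose f (C ^ n * initialDiam f u) y q := by
  induction n generalizing y with
  | zero =>
    obtain ⟨z, hz, hyz, -⟩ := exists_eq_one_orbitClose hf hu hy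
    exact ⟨z, hz, z, self_mem_orbit f z, by rwa [pow_zero, one_mul]⟩
  | succ n ih =>
    rw [Function.iterate_succ_apply'] at hy
    obtain ⟨i, x, rfl, hx, -⟩ := exists_fuzzyOperator_eq hf.continuous hρ.map_zero
      (iterate_fuzzyOperator_mem_compactUsc hf.continuous hρ
        (orbitalNormalCompactUsc_subset_compactUsc f hu) n) hy
    obtain ⟨z, hz, q, hq, hxq⟩ := ih hx
    refine ⟨z, hz, f i q, mapsTo_orbit f i z hq, ?_⟩
    rw [pow_succ', mul_assoc]
    exact hxq.map hf i

theorem exists_eq_one_mem_closure_orbit (hf : IsOrbitalContractive f C) (hρ : IsAdmissible ρ)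
    (hu : u ∈ orbitalNormalCompactUsc f) {r : ℕ → ℝ} (hr : Tendsto r atTop (𝓝 0))
    (hvu : ∀ n, DominatedWithin (r n) v ((fuzzyOperator f ρ)^[n] u)) {x : X} (hx : 0 < v x) :
    ∃ z, u z = 1 ∧ x ∈ closure (orbit f z) := by
  have happrox (n : ℕ) : ∃ z, u z = 1 ∧ ∃ q ∈ orbit f z,
      dist q x ≤ r n + C ^ n * initialDiam f u := by
    obtain ⟨y, hxy, hy⟩ := hvu n x hx
    obtain ⟨z, hz, q, hq, hyq, -⟩ := exists_mem_orbit_orbitClose hf hρ hu n (hx.trans_le hy)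
    exact ⟨z, hz, q, hq, by linarith [dist_triangle_left q x y, dist_comm x y]⟩
  choose z hz q hq hqx using happrox
  have hq_lim : Tendsto q atTop (𝓝 x) := by
    refine tendsto_iff_dist_tendsto_zero.2 (squeeze_zero (fun _ => dist_nonneg) hqx ?_)
    simpa only [zero_mul, add_zero] using hr.add
      ((tendsto_pow_atTop_nhds_zero_of_lt_one hf.nonneg hf.lt_one).mul_const (initialDiam f u))
  obtain ⟨a, ha, φ, hφ, hz_lim⟩ := (isCompact_setOf_le
    (orbitalNormalCompactUsc_subset_compactUsc f hu) one_pos).tendsto_subseq fun n => (hz n).ge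
  exact ⟨a, le_antisymm unitInterval.le_one' ha, hf.isClosed_setOf_mem_closure_orbit.mem_of_tendsto
    (hz_lim.prodMk_nhds (hq_lim.comp hφ.tendsto_atTop))
    (.of_forall fun n => subset_closure (hq (φ n)))⟩

theorem mem_orbitalNormalCompactUsc_of_dominatedWithin [CompleteSpace X]
    (hf : IsOrbitalContractive f C) (hρ : IsAdmissible ρ) (hu : u ∈ orbitalNormalCompactUsc f)
    (hv : v ∈ compactUsc X) {r : ℕ → ℝ} (hr : Tendsto r atTop (𝓝 0))
    (huv : ∀ n, DominatedWithin (r n) ((fuzzyOperator f ρ)^[n] u) v)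
    (hvu : ∀ n, DominatedWithin (r n) v ((fuzzyOperator f ρ)^[n] u)) :
    v ∈ orbitalNormalCompactUsc f := by
  have hone {z : X} (hz : u z = 1) := exists_mem_closure_orbit_eq_one hf hρ hv.1 hr huv hz
  obtain ⟨x₀, hx₀⟩ := hu.1.1.1
  obtain ⟨y₀, -, hy₀⟩ := hone hx₀
  refine ⟨⟨⟨⟨y₀, hy₀⟩, hv.2⟩, fun x hx => ?_⟩, hv.1⟩
  obtain ⟨z, hz, hxz⟩ := exists_eq_one_mem_closure_orbit hf hρ hu hr hvu hx
  obtain ⟨y, hyz, hy⟩ := hone hz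
  exact ⟨z, y, hyz, hxz, hy⟩

theorem exists_fixedPoint_dInf_iterate_le [CompleteSpace X] (hf : IsOrbitalContractive f C)
    (hρ : IsAdmissible ρ) (hu : u ∈ orbitalNormalCompactUsc f) :
    ∃ v ∈ orbitalNormalCompactUsc f, fuzzyOperator f ρ v = v ∧ ∀ n,
      dInf ((fuzzyOperator f ρ)^[n] u) v ≤ ENNReal.ofReal (C ^ n / (1 - C) * initialDiam f u) := by
  obtain ⟨v, hv, huv, hvu⟩ := exists_limit_iterate_fuzzyOperator hf hρ hu
  have hr := tendsto_pow_div_mul hf.nonneg hf.lt_one (initialDiam f u)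
  exact ⟨v, mem_orbitalNormalCompactUsc_of_dominatedWithin hf hρ hu hv hr huv hvu,
    fuzzyOperator_eq_self_of_dominatedWithin hf.continuous hρ
      (orbitalNormalCompactUsc_subset_compactUsc f hu) hv hr huv hvu,
    fun n => dInf_le_of_dominatedWithin (huv n) (hvu n)⟩

end Iterates

end OrbitalFuzzy

theorem mainTheorem1 {X ι : Type*} [MetricSpace X] [CompleteSpace X] [Finite ι]
    (f : ι → X → X) (ρ : ι → unitInterval → unitInterval) (C : ℝ)
    (hf : OrbitalFuzzy.IsOrbitalContractive f C) (hρ : OrbitalFuzzy.IsAdmissible ρ) :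
    OrbitalFuzzy.IsWeaklyPicardOn OrbitalFuzzy.dInf (OrbitalFuzzy.fuzzyOperator f ρ)
        (OrbitalFuzzy.orbitalNormalCompactUsc f) ∧
      ∀ u ∈ OrbitalFuzzy.orbitalNormalCompactUsc f, ∀ v ∈ OrbitalFuzzy.orbitalNormalCompactUsc f,
        Filter.Tendsto
            (fun n : ℕ => OrbitalFuzzy.dInf ((OrbitalFuzzy.fuzzyOperator f ρ)^[n] u) v)
            Filter.atTop (nhds 0) →
          ∀ m : ℕ,
            OrbitalFuzzy.dInf ((OrbitalFuzzy.fuzzyOperator f ρ)^[m] u) v ≤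
              ENNReal.ofReal (C ^ m / (1 - C) *
                Metric.diam (OrbitalFuzzy.fractalOperator f (OrbitalFuzzy.fuzzySupp u) ∪
                  OrbitalFuzzy.fuzzySupp u)) := by
  have hlim (u : X → unitInterval) : Tendsto (fun n => ENNReal.ofReal
      (C ^ n / (1 - C) * OrbitalFuzzy.initialDiam f u)) atTop (𝓝 0) := by
    simpa only [ENNReal.ofReal_zero] using
      ENNReal.tendsto_ofReal (OrbitalFuzzy.tendsto_pow_div_mul hf.nonneg hf.lt_one _)
  refine ⟨⟨OrbitalFuzzy.mapsTo_fuzzyOperator hf hρ, fun u hu => ?_⟩, fun u hu v' _ hv' => ?_⟩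
  · obtain ⟨v, hv, hfix, hle⟩ := OrbitalFuzzy.exists_fixedPoint_dInf_iterate_le hf hρ hu
    exact ⟨v, hv, hfix, tendsto_of_tendsto_of_tendsto_of_le_of_le tendsto_const_nhds (hlim u)
      (fun _ => zero_le) hle⟩
  · obtain ⟨v, -, -, hle⟩ := OrbitalFuzzy.exists_fixedPoint_dInf_iterate_le hf hρ hu
    exact OrbitalFuzzy.dInf_le_of_tendsto (hlim u) hle hv'
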